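/- Let $(X,d)$ be a metric space with a Borel measure $\mu$ that is Ahlfors $\gamma$-regular for some $\gamma>0$: there are $c_1,c_2>0$ with $c_1r^\gamma\le\mu(B(x,r))\le c_2r^\gamma$ for all $x\in X$, $r>0$. Let $s>0$ and put $\sigma=s/\gamma$. For real-valued $u\in L^2(X,\mu)$ let $$\mathscr E^{d,\mu}_{\sigma}(u)=\iint_{X\times X}\frac{|u(x)-u(y)|^2}{\mu(B(x,d(x,y)))^{1+2\sigma}}\,d\mu(x)\,d\mu(y),\qquad H^{\sigma}_{d,\mu}=\{u\in L^2(X,\mu):\mathscr E^{d,\mu}_\sigma(u)<\infty\},$$ with the norm $\|u\|_{H^\sigma_{d,\mu}}=\|u\|_{L^2}+\sqrt{\mathscr E^{d,\mu}_\sigma(u)}$. A linear subspace $V\subseteq H^\sigma_{d,\mu}$ is called a space of coercivity if it is complete for $\|\cdot\|_{H^\sigma_{d,\mu}}$ and there is $c>0$ with $\mathscr E^{d,\mu}_\sigma(u)\ge c\|u\|_{L^2}^2$ for all $u\in V$. Let $$B^{d,\mu}_{s/\gamma}(u,v)=\iint_{X\times X}\frac{u(x)-u(y)}{d(x,y)^s}\,\frac{v(x)-v(y)}{d(x,y)^s}\,\frac{d\mu(x)\,d\mu(y)}{d(x,y)^{\gamma}}.$$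 A dyadic family is a family $\mathcal D=\bigcup_{j\in\mathbb Z}\mathcal D_j$ of Borel subsets (cubes) of $X$ such that: each $\mathcal D_j$ is a partition of $X$; for some $0<\nu<1$ and constants $0<c\le C$, every $Q\in\mathcal D_j$ has $c\nu^j\le\operatorname{diam}Q\le C\nu^j$ and $c\le \sup\{r_1/r_2: B(x_1,r_1)\subseteq Q\subseteq B(x_2,r_2)\}\le C$; each $Q\in\mathcal D_{j+1}$ is contained in exactly one cube of $\mathcal D_j$; for each $Q\in\mathcal D_j$ the set $\vartheta(Q)$ of the cubes of $\mathcal D_{j+1}$ contained in $Q$ has at least $1$ and at most $M$ elements, $M$ independent of $Q$ and $j$; two cubes of $\mathcal D$ are disjoint or one contains the other; and for each $Q\in\mathcal D$ the union of the cubes of $\mathcal D$ containing $Q$ is $X$. A Haar system $\mathscr H=\bigcup_{Q}\mathscr H(Q)$ of $\mathcal D$ is a choice, for each cube $Q$, of a set $\mathscr H(Q)\subset L^2(X,\mu)$ that together with $\mu(Q)^{-1/2}\mathcal X_Q$ (not in $\mathscr H(Q)$) forms an orthonormal basis of the space of functions vanishing outside $Q$ and constant on each $Q'\in\vartheta(Q)$.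 Let $P_j$ be the orthogonal projection of $L^2(X,\mu)$ onto the space of $L^2$ functions constant on each $Q\in\mathcal D_j$, and, for $\lambda>0$, let $\Pi_\lambda$ be the orthogonal projection of $L^2(X,\mu)$ onto the closed linear span of the $h\in\mathscr H(Q)$, $Q\in\mathcal D$, $\mu(Q)>\lambda$. Theorem. (1) For every dyadic family $\mathcal D$ on $X$, the spaces $H^{s/\gamma}_{d,\mu}\cap\operatorname{Ker}\Pi_\lambda$ (for every Haar system of $\mathcal D$ and every $\lambda>0$) and $H^{s/\gamma}_{d,\mu}\cap\operatorname{Ker}P_j$ (for every $j\in\mathbb Z$) are spaces of coercivity. (2) On every space of coercivity $V=H^{s/\gamma,0}_{d,\mu}$, in particular on those in (1), the bilinear form $B=B^{d,\mu}_{s/\gamma}$ is bounded and coercive: there are constants $C$ and $c>0$ such that, for all $u,v\in V$, the integral defining $B(u,v)$ converges absolutely, $|B(u,v)|\le C\|u\|_{H^{s/\gamma}_{d,\mu}}\|v\|_{H^{s/\gamma}_{d,\mu}}$ and $B(u,u)\ge c\|u\|_{H^{s/\gamma}_{d,\mu}}^2$. Moreover, for every linear functional $f$ on $V$ that is bounded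 for $\|\cdot\|_{H^{s/\gamma}_{d,\mu}}$ there is a unique $u\in V$ with $B(u,v)=\langle f,v\rangle$ for all $v\in V$. -/

import Mathlib

open MeasureTheory Set Filter Topology
open scoped ENNReal

noncomputable section

namespace HomType

/-- Ahlfors `γ`-regularity of a Borel measure `μ` on a metric space, `γ > 0`:
`c₁ r ^ γ ≤ μ (B(x, r)) ≤ c₂ r ^ γ` for every point `x` and every `r > 0`. -/
structure AhlforsRegular {X : Type*} [MetricSpace X] [MeasurableSpace X]
    (γ : ℝ) (μ : Measure X) : Prop where
  pos : 0 < γ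
  regular : ∃ c₁ c₂ : ℝ, 0 < c₁ ∧ 0 < c₂ ∧ ∀ (x : X) (r : ℝ), 0 < r →
    ENNReal.ofReal (c₁ * r ^ γ) ≤ μ (Metric.ball x r) ∧
      μ (Metric.ball x r) ≤ ENNReal.ofReal (c₂ * r ^ γ)

section Dyadic

variable {X : Type*} [MetricSpace X]

/-- The eccentricity of a set: the supremum of `r(B₁) / r(B₂)` over the balls `B₁ ⊆ Q ⊆ B₂`. -/
def eccentricity (Q : Set X) : ℝ≥0∞ :=
  ⨆ (x₁ : X) (r₁ : ℝ) (x₂ : X) (r₂ : ℝ) (_ : 0 < r₁) (_ : 0 < r₂)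
    (_ : Metric.ball x₁ r₁ ⊆ Q) (_ : Q ⊆ Metric.ball x₂ r₂), ENNReal.ofReal (r₁ / r₂)

/-- The offspring of a cube `Q` of level `j`. -/
def offspring (D : ℤ → Set (Set X)) (j : ℤ) (Q : Set X) : Set (Set X) :=
  {Q' | Q' ∈ D (j + 1) ∧ Q' ⊆ Q}

/-- Christ's dyadic families; `D j` is the family of the cubes of level `j`, and the whole family
is the union of the `D j`. -/
structure IsDyadicFamily [MeasurableSpace X] (D : ℤ → Set (Set X)) : Prop where
  size : ∃ ν : ℝ, 0 < ν ∧ ν < 1 ∧ ∃ c C : ℝ, 0 < c ∧ 0 < C ∧ ∀ j : ℤ, ∀ Q ∈ D j,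
    (ENNReal.ofReal (c * ν ^ j) ≤ Metric.ediam Q ∧ Metric.ediam Q ≤ ENNReal.ofReal (C * ν ^ j)) ∧
    (ENNReal.ofReal c ≤ eccentricity Q ∧ eccentricity Q ≤ ENNReal.ofReal C)
  measurableSet : ∀ j : ℤ, ∀ Q ∈ D j, MeasurableSet Q
  partition : ∀ j : ℤ, Setoid.IsPartition (D j)
  parent : ∀ j : ℤ, ∀ Q ∈ D (j + 1), ∃! Q', Q' ∈ D j ∧ Q ⊆ Q'
  offspring_card : ∃ M : ℕ, ∀ j : ℤ, ∀ Q ∈ D j,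
    1 ≤ (offspring D j Q).encard ∧ (offspring D j Q).encard ≤ M
  nested : ∀ Q ∈ ⋃ j, D j, ∀ R ∈ ⋃ j, D j, R ∩ Q = ∅ ∨ R ⊆ Q ∨ Q ⊆ R
  quadrant : ∀ Q ∈ ⋃ j, D j, ⋃₀ {R | R ∈ ⋃ j, D j ∧ Q ⊆ R} = univ

end Dyadic

section Haar

variable {X : Type*} [MeasurableSpace X]

/-- The functions of `L²` that are (almost everywhere) constant on each set of the family `𝒬`
and vanish (almost everywhere) outside `S`. -/
def stepSpace (μ : Measure X) (𝒬 : Set (Set X)) (S : Set X) : Submodule ℝ (Lp ℝ 2 μ) where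
  carrier := {f | (∀ Q ∈ 𝒬, ∃ a : ℝ, ∀ᵐ x ∂μ, x ∈ Q → f x = a) ∧ ∀ᵐ x ∂μ, x ∉ S → f x = 0}
  zero_mem' := by
    refine ⟨fun Q _ => ⟨0, ?_⟩, ?_⟩
    · filter_upwards [Lp.coeFn_zero ℝ 2 μ] with x hx _ using hx
    · filter_upwards [Lp.coeFn_zero ℝ 2 μ] with x hx _ using hx
  add_mem' := by
    rintro f g ⟨hf, hf'⟩ ⟨hg, hg'⟩
    refine ⟨fun Q hQ => ?_, ?_⟩
    · obtain ⟨a, ha⟩ := hf Q hQ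
      obtain ⟨b, hb⟩ := hg Q hQ
      refine ⟨a + b, ?_⟩
      filter_upwards [Lp.coeFn_add f g, ha, hb] with x hx h1 h2 hxQ
      rw [hx, Pi.add_apply, h1 hxQ, h2 hxQ]
    · filter_upwards [Lp.coeFn_add f g, hf', hg'] with x hx h1 h2 hxS
      rw [hx, Pi.add_apply, h1 hxS, h2 hxS, add_zero]
  smul_mem' := by
    rintro c f ⟨hf, hf'⟩
    refine ⟨fun Q hQ => ?_, ?_⟩
    · obtain ⟨a, ha⟩ := hf Q hQ
      refine ⟨c * a, ?_⟩
      filter_upwards [Lp.coeFn_smul c f, ha] with x hx h1 hxQ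
      rw [hx, Pi.smul_apply, h1 hxQ, smul_eq_mul]
    · filter_upwards [Lp.coeFn_smul c f, hf'] with x hx h1 hxS
      rw [hx, Pi.smul_apply, h1 hxS, smul_zero]

/-- The space `V_j` of the functions of `L²` that are constant on each cube of level `j`. -/
def levelSpace (μ : Measure X) (D : ℤ → Set (Set X)) (j : ℤ) : Submodule ℝ (Lp ℝ 2 μ) :=
  stepSpace μ (D j) univ

/-- The orthogonal projector `P_j` of `L²` onto `V_j`. (The space `V_j` is closed; the closure is
written only so that the projector is available without a proof of this.) -/
def levelProj (μ : Measure X) (D : ℤ → Set (Set X)) (j : ℤ) : Lp ℝ 2 μ →L[ℝ] Lp ℝ 2 μ :=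
  (levelSpace μ D j).topologicalClosure.starProjection

open Classical in
/-- The normalized indicator `μ(Q)^{-1/2} 1_Q`, as an element of `L²` (set to be `0` if this is not
square integrable, which never occurs for the cubes of a dyadic family). -/
def normIndicator (μ : Measure X) (Q : Set X) : Lp ℝ 2 μ :=
  if h : MemLp (Q.indicator fun _ => (1 / √(μ.real Q) : ℝ)) 2 μ then h.toLp else 0

/-- A Haar system associated with the dyadic family `D`: `𝓗 j Q` is the set of the Haar functions
based on the cube `Q` of level `j`. Together with the normalized indicator of `Q` they form an
orthonormal basis of the space of the functions that vanish outside `Q` and are constant on each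
offspring of `Q`. (If `Q` has only one offspring then this forces `𝓗 j Q = ∅`.) -/
structure IsHaarSystem (μ : Measure X) (D : ℤ → Set (Set X))
    (𝓗 : ℤ → Set X → Set (Lp ℝ 2 μ)) : Prop where
  notMem : ∀ j : ℤ, ∀ Q ∈ D j, normIndicator μ Q ∉ 𝓗 j Q
  orthonormal : ∀ j : ℤ, ∀ Q ∈ D j,
    Orthonormal ℝ (Subtype.val : (insert (normIndicator μ Q) (𝓗 j Q) : Set _) → Lp ℝ 2 μ)
  span_eq : ∀ j : ℤ, ∀ Q ∈ D j,
    Submodule.span ℝ (insert (normIndicator μ Q) (𝓗 j Q)) = stepSpace μ (offspring D j Q) Q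

/-- The closed linear span `M_t` in `L²` of the Haar functions based on cubes with `μ(Q) > t`. -/
def haarSpace (μ : Measure X) (D : ℤ → Set (Set X)) (𝓗 : ℤ → Set X → Set (Lp ℝ 2 μ)) (t : ℝ) :
    Submodule ℝ (Lp ℝ 2 μ) :=
  (Submodule.span ℝ
    {h | ∃ j : ℤ, ∃ Q ∈ D j, ENNReal.ofReal t < μ Q ∧ h ∈ 𝓗 j Q}).topologicalClosure

/-- The orthogonal projector `Π_t` of `L²` onto `M_t`. -/
def haarProj (μ : Measure X) (D : ℤ → Set (Set X)) (𝓗 : ℤ → Set X → Set (Lp ℝ 2 μ)) (t : ℝ) :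
    Lp ℝ 2 μ →L[ℝ] Lp ℝ 2 μ :=
  haveI : CompleteSpace (haarSpace μ D 𝓗 t) := Submodule.topologicalClosure.completeSpace _
  (haarSpace μ D 𝓗 t).starProjection

end Haar

section Energy

variable {X : Type*} [MetricSpace X] [MeasurableSpace X]

/-- The energy `∬ |u(x) - u(y)|² / μ(B(x, d(x, y))) ^ (1 + 2σ) dμ(x) dμ(y)`. -/
def energy (μ : Measure X) (σ : ℝ) (u : X → ℝ) : ℝ≥0∞ :=
  ∫⁻ p : X × X, ENNReal.ofReal (|u p.1 - u p.2| ^ 2) /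
    μ (Metric.ball p.1 (dist p.1 p.2)) ^ (1 + 2 * σ) ∂(μ.prod μ)

/-- The norm `‖u‖_{L²} + (energy of u)^{1/2}`. -/
def sobolevNorm (μ : Measure X) (σ : ℝ) (u : Lp ℝ 2 μ) : ℝ :=
  ‖u‖ + √(energy μ σ u).toReal

/-- The integrand of the Dirichlet form. -/
def dirichletIntegrand (s γ : ℝ) (u v : X → ℝ) (p : X × X) : ℝ :=
  (u p.1 - u p.2) / dist p.1 p.2 ^ s * ((v p.1 - v p.2) / dist p.1 p.2 ^ s) / dist p.1 p.2 ^ γ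

/-- The Dirichlet form
`∬ (u(x) - u(y)) / d(x, y)^s * (v(x) - v(y)) / d(x, y)^s * d(x, y)^{-γ} dμ(x) dμ(y)`. -/
def dirichletForm (μ : Measure X) (s γ : ℝ) (u v : X → ℝ) : ℝ :=
  ∫ p : X × X, dirichletIntegrand s γ u v p ∂(μ.prod μ)

theorem AhlforsRegular.sigmaFinite [BorelSpace X] {γ : ℝ} {μ : Measure X}
    (h : AhlforsRegular γ μ) : SigmaFinite μ := by
  obtain ⟨c₁, c₂, -, -, H⟩ := h.regular
  rcases isEmpty_or_nonempty X with hX | ⟨⟨x₀⟩⟩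
  · have : μ = 0 := Measure.eq_zero_of_isEmpty μ
    rw [this]; infer_instance
  · refine ⟨⟨⟨fun n : ℕ => Metric.ball x₀ (n + 1), fun _ => trivial, fun n => ?_, ?_⟩⟩⟩
    · exact (H x₀ (n + 1) (by positivity)).2.trans_lt ENNReal.ofReal_lt_top
    · refine eq_univ_of_forall fun x => mem_iUnion.2 ?_
      obtain ⟨n, hn⟩ := exists_nat_gt (dist x x₀)
      exact ⟨n, Metric.mem_ball.2 (by linarith)⟩

theorem energy_congr {μ : Measure X} [SFinite μ] (σ : ℝ) {u v : X → ℝ}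
    (h : u =ᵐ[μ] v) : energy μ σ u = energy μ σ v := by
  have h1 := (Measure.quasiMeasurePreserving_fst (μ := μ) (ν := μ)).ae_eq_comp h
  have h2 := (Measure.quasiMeasurePreserving_snd (μ := μ) (ν := μ)).ae_eq_comp h
  refine lintegral_congr_ae ?_
  filter_upwards [h1, h2] with p hp1 hp2
  simp only [Function.comp_apply] at hp1 hp2
  rw [hp1, hp2]

theorem energy_smul (μ : Measure X) (σ : ℝ) (c : ℝ) (u : X → ℝ) :
    energy μ σ (c • u) = ENNReal.ofReal (c ^ 2) * energy μ σ u := by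
  unfold energy
  rw [← lintegral_const_mul' _ _ ENNReal.ofReal_ne_top]
  refine lintegral_congr fun p => ?_
  rw [← mul_div_assoc, ← ENNReal.ofReal_mul (sq_nonneg c)]
  congr 2
  simp only [Pi.smul_apply, smul_eq_mul, sq_abs]
  ring

theorem energy_add_le (μ : Measure X) (σ : ℝ) {u v : X → ℝ} (hu : Measurable u)
    (hv : Measurable v) :
    energy μ σ (u + v) ≤ ENNReal.ofReal 4 * energy μ σ u + ENNReal.ofReal 4 * energy μ σ v := by
  unfold energy
  rw [← lintegral_const_mul' _ _ ENNReal.ofReal_ne_top,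
    ← lintegral_const_mul' _ _ ENNReal.ofReal_ne_top]
  have hA : MeasurableSet {p : X × X | |v p.1 - v p.2| ≤ |u p.1 - u p.2|} := by
    refine measurableSet_le ?_ ?_
    · exact ((hv.comp measurable_fst).sub (hv.comp measurable_snd)).abs
    · exact ((hu.comp measurable_fst).sub (hu.comp measurable_snd)).abs
  rw [← lintegral_add_compl _ hA]
  refine add_le_add ?_ ?_
  · refine (setLIntegral_mono' hA fun p hp => ?_).trans (setLIntegral_le_lintegral _ _)
    rw [← mul_div_assoc, ← ENNReal.ofReal_mul (by norm_num)]
    refine ENNReal.div_le_div_right (ENNReal.ofReal_le_ofReal ?_) _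
    have hp' : |v p.1 - v p.2| ≤ |u p.1 - u p.2| := hp
    have : |(u + v) p.1 - (u + v) p.2| ≤ 2 * |u p.1 - u p.2| := by
      calc |(u + v) p.1 - (u + v) p.2| = |(u p.1 - u p.2) + (v p.1 - v p.2)| := by
            simp only [Pi.add_apply]; congr 1; ring
        _ ≤ |u p.1 - u p.2| + |v p.1 - v p.2| := abs_add_le _ _
        _ ≤ _ := by linarith
    nlinarith [abs_nonneg ((u + v) p.1 - (u + v) p.2)]
  · refine (setLIntegral_mono' hA.compl fun p hp => ?_).trans (setLIntegral_le_lintegral _ _)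
    rw [← mul_div_assoc, ← ENNReal.ofReal_mul (by norm_num)]
    refine ENNReal.div_le_div_right (ENNReal.ofReal_le_ofReal ?_) _
    have hp' : |u p.1 - u p.2| < |v p.1 - v p.2| := not_le.1 hp
    have : |(u + v) p.1 - (u + v) p.2| ≤ 2 * |v p.1 - v p.2| := by
      calc |(u + v) p.1 - (u + v) p.2| = |(u p.1 - u p.2) + (v p.1 - v p.2)| := by
            simp only [Pi.add_apply]; congr 1; ring
        _ ≤ |u p.1 - u p.2| + |v p.1 - v p.2| := abs_add_le _ _
        _ ≤ _ := by linarith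
    nlinarith [abs_nonneg ((u + v) p.1 - (u + v) p.2)]

/-- The space of the functions of `L²` with finite energy. The regularity hypothesis serves only to
see that this is a vector space. -/
def sobolevSpace [BorelSpace X] {γ : ℝ} {μ : Measure X} (h : AhlforsRegular γ μ) (σ : ℝ) :
    Submodule ℝ (Lp ℝ 2 μ) where
  carrier := {u | energy μ σ u < ∞}
  zero_mem' := by
    have := h.sigmaFinite
    change energy μ σ _ < ∞
    rw [energy_congr σ (Lp.coeFn_zero ℝ 2 μ)]
    simp [energy]
  add_mem' := by
    have := h.sigmaFinite
    intro u v hu hv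
    change energy μ σ _ < ∞
    rw [energy_congr σ (Lp.coeFn_add u v)]
    refine (energy_add_le μ σ (Lp.stronglyMeasurable u).measurable
      (Lp.stronglyMeasurable v).measurable).trans_lt ?_
    exact ENNReal.add_lt_top.2 ⟨ENNReal.mul_lt_top ENNReal.ofReal_lt_top hu,
      ENNReal.mul_lt_top ENNReal.ofReal_lt_top hv⟩
  smul_mem' := by
    have := h.sigmaFinite
    intro c u hu
    change energy μ σ _ < ∞
    rw [energy_congr σ (Lp.coeFn_smul c u), energy_smul]
    exact ENNReal.mul_lt_top ENNReal.ofReal_lt_top hu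

/-- A space of coercivity for the energy: a subspace of the space of the functions of `L²` with
finite energy that is complete for the norm `sobolevNorm` (a Hilbert subspace) and on which the
energy dominates a positive multiple of the square of the `L²` norm. -/
structure IsCoercivitySpace [BorelSpace X] {γ : ℝ} {μ : Measure X} (h : AhlforsRegular γ μ)
    (σ : ℝ) (V : Submodule ℝ (Lp ℝ 2 μ)) : Prop where
  le_sobolevSpace : V ≤ sobolevSpace h σ
  complete : ∀ w : ℕ → Lp ℝ 2 μ, (∀ n, w n ∈ V) →
    (∀ ε > 0, ∃ N, ∀ m ≥ N, ∀ n ≥ N, sobolevNorm μ σ (w m - w n) < ε) →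
    ∃ u ∈ V, Tendsto (fun n => sobolevNorm μ σ (w n - u)) atTop (𝓝 0)
  coercive : ∃ c : ℝ, 0 < c ∧ ∀ u ∈ V, ENNReal.ofReal (c * ‖u‖ ^ 2) ≤ energy μ σ u

end Energy

end HomType

end

/-!
Put `T u (x, y) = (u x - u y) / d (x, y) ^ (s + γ / 2)`. Then `B (u, v)` is the inner product of
`T u` and `T v` in `L² (μ × μ)`, and by regularity the energy of `u` is comparable to `‖T u‖²`. On a
space of coercivity `‖T u‖` is therefore a norm equivalent to the Sobolev norm, and the
representation of functionals is the Riesz theorem on the range of `T`, which is complete.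

As `T` is a closed operator, the functions of its domain that lie in a given closed subspace of `L²`
form a complete space. If moreover they have mean zero on all the cubes of one level, they satisfy
a Poincaré inequality on each cube, with a uniform constant since these cubes have comparable sizes,
and summing over the cubes gives coercivity. The mean zero property is immediate on the kernel of
`P_j`. On the kernel of `Π_t`, orthogonality to the Haar functions says that a cube of measure
greater than `t` and its offspring have the same average; hence this average is shared by ancestors
of arbitrarily large measure, and it vanishes because `u` is in `L²`.
-/

open scoped NNReal

noncomputable section

namespace HomType

section Measures

variable {X : Type*} [MeasurableSpace X] {μ : Measure X}

theorem countable_of_pairwiseDisjoint_of_measure_pos [SFinite μ] {ι : Type*} {S : Set ι}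
    {As : ι → Set X} (hm : ∀ i ∈ S, MeasurableSet (As i)) (hdisj : S.PairwiseDisjoint As)
    (hpos : ∀ i ∈ S, 0 < μ (As i)) : S.Countable := by
  have h := Measure.countable_meas_pos_of_disjoint_iUnion (μ := μ) (As := fun i : S => As i)
    (fun i => hm i i.2) fun i j hij => hdisj i.2 j.2 (Subtype.coe_ne_coe.2 hij)
  exact countable_coe_iff.1 (countable_univ_iff.1 (h.mono fun i _ => hpos i i.2))

theorem secondCountableTopology_of_isOpenPosMeasure {X : Type*} [PseudoMetricSpace X]
    [MeasurableSpace X] [OpensMeasurableSpace X] (μ : Measure X) [SFinite μ]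
    [μ.IsOpenPosMeasure] : SecondCountableTopology X := by
  refine Metric.secondCountable_of_almost_dense_set fun ε hε => ?_
  obtain ⟨S, -, hdisj, hcov⟩ := Vitali.exists_disjoint_subfamily_covering_enlargement_closedBall
    (univ : Set X) id (fun _ => ε / 5) (ε / 5) (fun _ _ => le_rfl) 5 (by norm_num)
  refine ⟨S, countable_of_pairwiseDisjoint_of_measure_pos (μ := μ)
    (fun _ _ => measurableSet_closedBall) hdisj
    (fun x _ => Metric.measure_closedBall_pos μ x (by positivity)), fun x => ?_⟩
  obtain ⟨b, hb, hsub⟩ := hcov x (mem_univ x)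
  have hx : dist x b ≤ 5 * (ε / 5) := hsub (Metric.mem_closedBall_self (by positivity))
  exact ⟨b, hb, hx.trans_eq (by ring)⟩

theorem eLpNorm_two_sq_eq_lintegral {ε : Type*} [ENorm ε] (f : X → ε) :
    eLpNorm f 2 μ ^ 2 = ∫⁻ x, ‖f x‖ₑ ^ 2 ∂μ := by
  simpa using eLpNorm_nnreal_pow_eq_lintegral (f := f) (μ := μ) (p := 2) two_ne_zero

theorem enorm_sq_eq_lintegral {E : Type*} [NormedAddCommGroup E] (f : Lp E 2 μ) :
    ‖f‖ₑ ^ 2 = ∫⁻ x, ‖f x‖ₑ ^ 2 ∂μ := by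
  rw [Lp.enorm_def, eLpNorm_two_sq_eq_lintegral]

end Measures

section Regular

variable {X : Type*} [MetricSpace X] [MeasurableSpace X] {γ : ℝ} {μ : Measure X}

theorem AhlforsRegular.isOpenPosMeasure (h : AhlforsRegular γ μ) : μ.IsOpenPosMeasure := by
  obtain ⟨c₁, c₂, h₁, -, H⟩ := h.regular
  refine ⟨fun U hU ⟨x, hx⟩ => ?_⟩
  obtain ⟨r, hr, hrU⟩ := Metric.isOpen_iff.1 hU x hx
  have hball := (ENNReal.ofReal_pos.2 (by positivity)).trans_le (H x r hr).1
  exact (hball.trans_le (measure_mono hrU)).ne'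

theorem AhlforsRegular.measure_lt_top (h : AhlforsRegular γ μ) {S : Set X}
    (hS : Bornology.IsBounded S) : μ S < ∞ := by
  obtain ⟨c₁, c₂, -, -, H⟩ := h.regular
  rcases S.eq_empty_or_nonempty with rfl | ⟨x, -⟩
  · simp only [measure_empty, ENNReal.zero_lt_top]
  · obtain ⟨r, hr, hSr⟩ := hS.subset_ball_lt 0 x
    exact (measure_mono hSr).trans_lt ((H x r hr).2.trans_lt ENNReal.ofReal_lt_top)

theorem AhlforsRegular.secondCountableTopology [BorelSpace X] (h : AhlforsRegular γ μ) :
    SecondCountableTopology X :=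
  haveI := h.sigmaFinite
  haveI := h.isOpenPosMeasure
  secondCountableTopology_of_isOpenPosMeasure μ

theorem AhlforsRegular.exists_measure_ball_rpow_comparable (h : AhlforsRegular γ μ) {q : ℝ}
    (hq : 0 ≤ q) : ∃ A : ℝ≥0, A ≠ 0 ∧ ∀ (x : X) (r : ℝ), 0 < r →
      ENNReal.ofReal (r ^ (γ * q)) ≤ A * μ (Metric.ball x r) ^ q ∧
        μ (Metric.ball x r) ^ q ≤ A * ENNReal.ofReal (r ^ (γ * q)) := by
  obtain ⟨c₁, c₂, h₁, h₂, H⟩ := h.regular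
  have hrpow {c r : ℝ} (hc : 0 < c) (hr : 0 < r) :
      ENNReal.ofReal (c * r ^ γ) ^ q = ENNReal.ofReal (c ^ q * r ^ (γ * q)) := by
    rw [ENNReal.ofReal_rpow_of_nonneg (by positivity) hq, Real.mul_rpow hc.le (by positivity),
      ← Real.rpow_mul hr.le]
  set A : ℝ := max (c₁ ^ q)⁻¹ (c₂ ^ q)
  have hA : 0 < A := lt_max_of_lt_right (by positivity)
  refine ⟨A.toNNReal, (Real.toNNReal_pos.2 hA).ne', fun x r hr => ⟨?_, ?_⟩⟩
  · calc ENNReal.ofReal (r ^ (γ * q))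
        = ENNReal.ofReal (c₁ ^ q)⁻¹ * ENNReal.ofReal (c₁ * r ^ γ) ^ q := by
          rw [hrpow h₁ hr, ← ENNReal.ofReal_mul (by positivity),
            inv_mul_cancel_left₀ (by positivity)]
      _ ≤ ENNReal.ofReal A * μ (Metric.ball x r) ^ q := by
          gcongr
          exacts [le_max_left _ _, (H x r hr).1]
  · calc μ (Metric.ball x r) ^ q ≤ ENNReal.ofReal (c₂ * r ^ γ) ^ q := by
          gcongr
          exact (H x r hr).2
      _ = ENNReal.ofReal (c₂ ^ q) * ENNReal.ofReal (r ^ (γ * q)) := by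
          rw [hrpow h₂ hr, ENNReal.ofReal_mul (by positivity)]
      _ ≤ ENNReal.ofReal A * ENNReal.ofReal (r ^ (γ * q)) := by
          gcongr
          exact le_max_right _ _

end Regular

theorem div_le_mul_div_of_le_mul {A : ℝ≥0} (hA : A ≠ 0) {a b c : ℝ≥0∞} (hbc : c ≤ A * b) :
    a / b ≤ A * (a / c) := by
  have hA' : (A : ℝ≥0∞) ≠ 0 := ENNReal.coe_ne_zero.2 hA
  calc a / b = A * (a / (A * b)) := by
        rw [← mul_div_assoc, ENNReal.mul_div_mul_left _ _ hA' ENNReal.coe_ne_top]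
    _ ≤ A * (a / c) := by gcongr

section DifferenceQuotient

variable {X : Type*} [MetricSpace X]

/-- The fractional difference quotient of `u` at a pair of points. The exponent splits the weight
`d(x, y) ^ (2 s + γ)` of the Dirichlet form evenly between its two arguments, so that the form is
the `L²` inner product of difference quotients. On the diagonal the value is `0 / _ = 0`. -/
def diffQuot (s γ : ℝ) (u : X → ℝ) (p : X × X) : ℝ :=
  (u p.1 - u p.2) / dist p.1 p.2 ^ (s + γ / 2)

theorem dirichletIntegrand_eq_mul (s γ : ℝ) (u v : X → ℝ) (p : X × X) :
    dirichletIntegrand s γ u v p = diffQuot s γ u p * diffQuot s γ v p := by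
  rcases eq_or_ne p.1 p.2 with hp | hp
  · simp [dirichletIntegrand, diffQuot, hp]
  have hd := dist_pos.2 hp
  have hsplit : dist p.1 p.2 ^ s * dist p.1 p.2 ^ s * dist p.1 p.2 ^ γ =
      dist p.1 p.2 ^ (s + γ / 2) * dist p.1 p.2 ^ (s + γ / 2) := by
    rw [← Real.rpow_add hd, ← Real.rpow_add hd, ← Real.rpow_add hd]
    ring_nf
  rw [dirichletIntegrand, diffQuot, diffQuot, div_mul_div_comm, div_div, hsplit, div_mul_div_comm]

theorem enorm_diffQuot_sq (s γ : ℝ) (u : X → ℝ) (p : X × X) :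
    ‖diffQuot s γ u p‖ₑ ^ 2 =
      ‖u p.1 - u p.2‖ₑ ^ 2 / ENNReal.ofReal (dist p.1 p.2 ^ (γ + 2 * s)) := by
  rcases eq_or_ne p.1 p.2 with hp | hp
  · simp [diffQuot, hp]
  have hd := dist_pos.2 hp
  have hsq : dist p.1 p.2 ^ (γ + 2 * s) = (dist p.1 p.2 ^ (s + γ / 2)) ^ 2 := by
    rw [← Real.rpow_mul_natCast hd.le]
    congr 1
    push_cast
    ring
  rw [hsq, ← enorm_pow, diffQuot, div_pow, Real.enorm_of_nonneg (by positivity),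
    ENNReal.ofReal_div_of_pos (by positivity), ← Real.enorm_of_nonneg (by positivity), enorm_pow]

variable [MeasurableSpace X]

theorem measurable_diffQuot [OpensMeasurableSpace X] [SecondCountableTopology X] (s γ : ℝ)
    {u : X → ℝ} (hu : Measurable u) : Measurable (diffQuot s γ u) :=
  ((hu.comp measurable_fst).sub (hu.comp measurable_snd)).div (measurable_dist.pow_const _)

theorem diffQuot_congr {μ : Measure X} [SFinite μ] (s γ : ℝ) {u v : X → ℝ} (h : u =ᵐ[μ] v) :
    diffQuot s γ u =ᵐ[μ.prod μ] diffQuot s γ v := by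
  filter_upwards [Measure.quasiMeasurePreserving_fst.ae h,
    Measure.quasiMeasurePreserving_snd.ae h] with p hp₁ hp₂
  rw [diffQuot, diffQuot, hp₁, hp₂]

/-- The squared `L²` norm of the difference quotient, that is, the energy with the measure of the
ball replaced by the power of its radius to which regularity makes it comparable. -/
def distEnergy (μ : Measure X) (s γ : ℝ) (u : X → ℝ) : ℝ≥0∞ :=
  ∫⁻ p : X × X, ‖diffQuot s γ u p‖ₑ ^ 2 ∂(μ.prod μ)

theorem AhlforsRegular.energy_comparable {γ : ℝ} {μ : Measure X} (h : AhlforsRegular γ μ) {s : ℝ}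
    (hs : 0 ≤ s) : ∃ A : ℝ≥0, A ≠ 0 ∧ ∀ u : X → ℝ,
      energy μ (s / γ) u ≤ A * distEnergy μ s γ u ∧
        distEnergy μ s γ u ≤ A * energy μ (s / γ) u := by
  have hγ := h.pos
  obtain ⟨A, hA, H⟩ := h.exists_measure_ball_rpow_comparable (q := 1 + 2 * (s / γ))
    (by positivity)
  have hexp : γ * (1 + 2 * (s / γ)) = γ + 2 * s := by field_simp
  have hsq (a : ℝ) : ENNReal.ofReal (|a| ^ 2) = ‖a‖ₑ ^ 2 := by
    rw [ENNReal.ofReal_pow (abs_nonneg a), Real.enorm_eq_ofReal_abs]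
  refine ⟨A, hA, fun u => ⟨?_, ?_⟩⟩ <;>
    rw [distEnergy, energy, ← lintegral_const_mul' _ _ ENNReal.coe_ne_top] <;>
    refine lintegral_mono fun p => ?_ <;>
    simp only [enorm_diffQuot_sq, hsq] <;>
    rcases eq_or_ne p.1 p.2 with hp | hp
  · simp [hp]
  · exact div_le_mul_div_of_le_mul hA (hexp ▸ (H p.1 _ (dist_pos.2 hp)).1)
  · simp [hp]
  · exact div_le_mul_div_of_le_mul hA (hexp ▸ (H p.1 _ (dist_pos.2 hp)).2)

end DifferenceQuotient

theorem isComplete_range_iff {V F : Type*} [AddCommGroup V] [SeminormedAddCommGroup F]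
    (T : V →+ F) {N : V → ℝ} {A B : ℝ} (hA : 0 < A) (hB : 0 < B)
    (hTN : ∀ v, ‖T v‖ ≤ A * N v) (hNT : ∀ v, N v ≤ B * ‖T v‖) :
    IsComplete (range T) ↔ ∀ w : ℕ → V,
      (∀ ε > 0, ∃ n₀, ∀ m ≥ n₀, ∀ n ≥ n₀, N (w m - w n) < ε) →
        ∃ v, Tendsto (fun n => N (w n - v)) atTop (𝓝 0) := by
  have cauchySeq_iff (w : ℕ → V) : CauchySeq (fun n => T (w n)) ↔
      ∀ ε > 0, ∃ n₀, ∀ m ≥ n₀, ∀ n ≥ n₀, N (w m - w n) < ε := by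
    simp only [Metric.cauchySeq_iff, dist_eq_norm, ← map_sub]
    refine ⟨fun h ε hε => (h (ε / B) (by positivity)).imp fun n₀ hn₀ m hm n hn => ?_,
      fun h ε hε => (h (ε / A) (by positivity)).imp fun n₀ hn₀ m hm n hn => ?_⟩
    · exact (hNT _).trans_lt ((lt_div_iff₀' hB).1 (hn₀ m hm n hn))
    · exact (hTN _).trans_lt ((lt_div_iff₀' hA).1 (hn₀ m hm n hn))
  have tendsto_iff (w : ℕ → V) (v : V) : Tendsto (fun n => T (w n)) atTop (𝓝 (T v)) ↔
      Tendsto (fun n => N (w n - v)) atTop (𝓝 0) := by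
    rw [tendsto_iff_norm_sub_tendsto_zero]
    simp only [← map_sub]
    have hN0 (v : V) : 0 ≤ N v :=
      nonneg_of_mul_nonneg_right ((norm_nonneg _).trans (hTN v)) hA
    refine ⟨fun h => squeeze_zero (fun n => hN0 _) (fun n => hNT _) ?_,
      fun h => squeeze_zero (fun n => norm_nonneg _) (fun n => hTN _) ?_⟩
    · simpa only [mul_zero] using h.const_mul B
    · simpa only [mul_zero] using h.const_mul A
  constructor
  · intro h w hw
    obtain ⟨-, ⟨v, rfl⟩, hv⟩ := cauchySeq_tendsto_of_isComplete h
      (fun n => mem_range_self (w n)) ((cauchySeq_iff w).2 hw)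
    exact ⟨v, (tendsto_iff w v).1 hv⟩
  · intro h
    refine completeSpace_coe_iff_isComplete.1 (Metric.complete_of_cauchySeq_tendsto fun y hy => ?_)
    choose w hw using fun n => (y n).2
    have hcauchy : CauchySeq fun n => T (w n) := by
      simp only [hw]
      exact uniformContinuous_subtype_val.comp_cauchySeq hy
    obtain ⟨v, hv⟩ := h w ((cauchySeq_iff w).1 hcauchy)
    refine ⟨⟨T v, mem_range_self v⟩, tendsto_subtype_rng.2 ?_⟩
    simpa only [hw] using (tendsto_iff w v).2 hv

theorem existsUnique_inner_map_eq {𝕜 V H : Type*} [RCLike 𝕜] [AddCommGroup V] [Module 𝕜 V]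
    [NormedAddCommGroup H] [InnerProductSpace 𝕜 H] (T : V →ₗ[𝕜] H) (hinj : Function.Injective T)
    (hcomplete : IsComplete (range T)) (f : V →ₗ[𝕜] 𝕜) {K : ℝ}
    (hf : ∀ v, ‖f v‖ ≤ K * ‖T v‖) : ∃! u : V, ∀ v : V, inner 𝕜 (T u) (T v) = f v := by
  have : CompleteSpace (LinearMap.range T) := hcomplete.completeSpace_coe
  let e := LinearEquiv.ofInjective T hinj
  let F : LinearMap.range T →L[𝕜] 𝕜 := (f ∘ₗ e.symm.toLinearMap).mkContinuous K fun y => by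
    obtain ⟨v, rfl⟩ := e.surjective y
    change ‖f (e.symm (e v))‖ ≤ K * ‖T v‖
    rw [e.symm_apply_apply]
    exact hf v
  obtain ⟨u, hu⟩ := e.surjective ((InnerProductSpace.toDual 𝕜 (LinearMap.range T)).symm F)
  have hrep (v : V) : inner 𝕜 (T u) (T v) = f v :=
    calc inner 𝕜 (e u) (e v) = F (e v) := by rw [hu, InnerProductSpace.toDual_symm_apply]
      _ = f v := congrArg f (e.symm_apply_apply v)
  refine ⟨u, hrep, fun u' hu' => hinj (sub_eq_zero.1 ?_)⟩
  have horth : inner 𝕜 (T u' - T u) (T (u' - u)) = 0 := by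
    rw [inner_sub_left, hu', hrep, sub_self]
  rwa [map_sub, inner_self_eq_zero] at horth

theorem mem_span_of_mem_span_insert_of_inner_eq_zero {𝕜 H : Type*} [RCLike 𝕜]
    [NormedAddCommGroup H] [InnerProductSpace 𝕜 H] {e g : H} {S : Set H}
    (hS : ∀ y ∈ S, inner 𝕜 e y = 0) (hg : g ∈ Submodule.span 𝕜 (insert e S))
    (heg : inner 𝕜 e g = 0) : g ∈ Submodule.span 𝕜 S := by
  obtain ⟨a, z, hz, rfl⟩ := Submodule.mem_span_insert.1 hg
  have hez : inner 𝕜 e z = 0 :=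
    Submodule.mem_orthogonal_singleton_iff_inner_right.1
      (Submodule.span_le.2 (fun y hy => Submodule.mem_orthogonal_singleton_iff_inner_right.2
        (hS y hy)) hz)
  have hae : a • e = 0 := by
    have := inner_add_right (𝕜 := 𝕜) e (a • e) z
    rw [heg, hez, add_zero, inner_smul_right, eq_comm, mul_eq_zero, inner_self_eq_zero,
      ← smul_eq_zero] at this
    exact this
  rwa [hae, zero_add]

section Sobolev

variable {X : Type*} [MetricSpace X] [MeasurableSpace X] [BorelSpace X] {γ s : ℝ} {μ : Measure X}

theorem AhlforsRegular.memLp_diffQuot_iff (h : AhlforsRegular γ μ) (hs : 0 ≤ s) (u : Lp ℝ 2 μ) :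
    MemLp (diffQuot s γ u) 2 (μ.prod μ) ↔ u ∈ sobolevSpace h (s / γ) := by
  have := h.secondCountableTopology
  have hmeas : AEStronglyMeasurable (diffQuot s γ u) (μ.prod μ) :=
    (measurable_diffQuot s γ (Lp.stronglyMeasurable u).measurable).aestronglyMeasurable
  have hL2 : MemLp (diffQuot s γ u) 2 (μ.prod μ) ↔ distEnergy μ s γ u < ∞ := by
    rw [distEnergy, ← eLpNorm_two_sq_eq_lintegral, ENNReal.pow_lt_top_iff, MemLp]
    simp [hmeas]
  obtain ⟨A, -, H⟩ := h.energy_comparable hs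
  rw [hL2]
  exact ⟨fun hu => (H u).1.trans_lt (ENNReal.mul_lt_top ENNReal.coe_lt_top hu),
    fun hu => (H u).2.trans_lt (ENNReal.mul_lt_top ENNReal.coe_lt_top hu)⟩

/-- The difference quotient as a linear operator from the Sobolev space to `L²(μ × μ)`. -/
def diffQuotLin (h : AhlforsRegular γ μ) (hs : 0 ≤ s) :
    sobolevSpace h (s / γ) →ₗ[ℝ] Lp ℝ 2 (μ.prod μ) where
  toFun u := ((h.memLp_diffQuot_iff hs u).2 u.2).toLp
  map_add' u v := by
    have := h.sigmaFinite
    rw [← MemLp.toLp_add]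
    refine MemLp.toLp_congr _ _ ((diffQuot_congr s γ (Lp.coeFn_add (u : Lp ℝ 2 μ) v)).trans
      (Eventually.of_forall fun p => ?_))
    simp only [diffQuot, Pi.add_apply]
    ring
  map_smul' c u := by
    have := h.sigmaFinite
    rw [RingHom.id_apply, ← MemLp.toLp_const_smul]
    refine MemLp.toLp_congr _ _ ((diffQuot_congr s γ (Lp.coeFn_smul c (u : Lp ℝ 2 μ))).trans
      (Eventually.of_forall fun p => ?_))
    simp only [diffQuot, Pi.smul_apply, smul_eq_mul]
    ring

variable (h : AhlforsRegular γ μ)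

theorem coeFn_diffQuotLin (hs : 0 ≤ s) (u : sobolevSpace h (s / γ)) :
    diffQuotLin h hs u =ᵐ[μ.prod μ] diffQuot s γ (u : Lp ℝ 2 μ) :=
  MemLp.coeFn_toLp ((h.memLp_diffQuot_iff hs (u : Lp ℝ 2 μ)).2 u.2)

theorem dirichletIntegrand_ae_eq (hs : 0 ≤ s) (u v : sobolevSpace h (s / γ)) :
    dirichletIntegrand s γ (u : Lp ℝ 2 μ) (v : Lp ℝ 2 μ) =ᵐ[μ.prod μ]
      fun p => inner ℝ (diffQuotLin h hs u p) (diffQuotLin h hs v p) := by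
  filter_upwards [coeFn_diffQuotLin h hs u, coeFn_diffQuotLin h hs v] with p hu hv
  rw [dirichletIntegrand_eq_mul, hu, hv, real_inner_comm]
  rfl

theorem integrable_dirichletIntegrand (hs : 0 ≤ s) (u v : sobolevSpace h (s / γ)) :
    Integrable (dirichletIntegrand s γ (u : Lp ℝ 2 μ) (v : Lp ℝ 2 μ)) (μ.prod μ) :=
  (L2.integrable_inner (diffQuotLin h hs u) (diffQuotLin h hs v)).congr
    (dirichletIntegrand_ae_eq h hs u v).symm

theorem dirichletForm_eq_inner (hs : 0 ≤ s) (u v : sobolevSpace h (s / γ)) :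
    dirichletForm μ s γ (u : Lp ℝ 2 μ) (v : Lp ℝ 2 μ) =
      inner ℝ (diffQuotLin h hs u) (diffQuotLin h hs v) := by
  rw [L2.inner_def, dirichletForm, integral_congr_ae (dirichletIntegrand_ae_eq h hs u v)]

theorem enorm_diffQuotLin_sq (hs : 0 ≤ s) (u : sobolevSpace h (s / γ)) :
    ‖diffQuotLin h hs u‖ₑ ^ 2 = distEnergy μ s γ (u : Lp ℝ 2 μ) := by
  rw [enorm_sq_eq_lintegral, distEnergy]
  refine lintegral_congr_ae ?_
  filter_upwards [coeFn_diffQuotLin h hs u] with p hp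
  rw [hp]

theorem exists_energy_comparable_norm_diffQuotLin (hs : 0 ≤ s) : ∃ A : ℝ, 0 < A ∧
    ∀ u : sobolevSpace h (s / γ),
      √(energy μ (s / γ) (u : Lp ℝ 2 μ)).toReal ≤ A * ‖diffQuotLin h hs u‖ ∧
      ‖diffQuotLin h hs u‖ ≤ A * √(energy μ (s / γ) (u : Lp ℝ 2 μ)).toReal := by
  obtain ⟨A, hA, H⟩ := h.energy_comparable hs
  have sqrt_toReal_le {a b : ℝ≥0∞} (hb : b ≠ ∞) (hab : a ≤ A * b) :
      √a.toReal ≤ √A * √b.toReal := by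
    rw [← Real.sqrt_mul A.coe_nonneg]
    exact Real.sqrt_le_sqrt (by simpa using ENNReal.toReal_mono (by finiteness) hab)
  have hnorm (u : sobolevSpace h (s / γ)) :
      ‖diffQuotLin h hs u‖ = √(distEnergy μ s γ (u : Lp ℝ 2 μ)).toReal := by
    rw [← enorm_diffQuotLin_sq h hs, ENNReal.toReal_pow, toReal_enorm,
      Real.sqrt_sq (norm_nonneg _)]
  refine ⟨√A, by positivity, fun u => ?_⟩
  have hfin : distEnergy μ s γ (u : Lp ℝ 2 μ) ≠ ∞ := by
    rw [← enorm_diffQuotLin_sq h hs]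
    finiteness
  rw [hnorm]
  exact ⟨sqrt_toReal_le hfin (H _).1, sqrt_toReal_le (ne_of_lt u.2) (H _).2⟩

/- Along a subsequence both `L²` limits are almost everywhere limits, and the difference quotient of
a pointwise limit is the pointwise limit of the difference quotients. -/
theorem isClosed_diffQuotLin (hs : 0 ≤ s) :
    (LinearPMap.mk (sobolevSpace h (s / γ)) (diffQuotLin h hs)).IsClosed := by
  have := h.sigmaFinite
  have := h.secondCountableTopology
  refine IsSeqClosed.isClosed fun x ug hx hlim => ?_
  obtain ⟨u, g⟩ := ug
  choose w hw using fun n => (LinearPMap.mem_graph_iff _).1 (hx n)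
  have hu : Tendsto (fun n => (w n : Lp ℝ 2 μ)) atTop (𝓝 u) :=
    ((continuous_fst.tendsto _).comp hlim).congr fun n => (hw n).1.symm
  have hg : Tendsto (fun n => diffQuotLin h hs (w n)) atTop (𝓝 g) :=
    ((continuous_snd.tendsto _).comp hlim).congr fun n => (hw n).2.symm
  obtain ⟨a, ha, hau⟩ := (tendstoInMeasure_of_tendsto_Lp hu).exists_seq_tendsto_ae
  obtain ⟨b, hb, hbg⟩ := (tendstoInMeasure_of_tendsto_Lp
    (hg.comp ha.tendsto_atTop)).exists_seq_tendsto_ae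
  have hae : diffQuot s γ u =ᵐ[μ.prod μ] g := by
    filter_upwards [Measure.quasiMeasurePreserving_fst.ae hau,
      Measure.quasiMeasurePreserving_snd.ae hau, hbg,
      ae_all_iff.2 fun n => coeFn_diffQuotLin h hs (w (a (b n)))] with p hp₁ hp₂ hpg hpw
    refine tendsto_nhds_unique (Tendsto.congr (fun n => (hpw n).symm) ?_) hpg
    exact ((hp₁.comp hb.tendsto_atTop).sub (hp₂.comp hb.tendsto_atTop)).div_const _
  have hmem : u ∈ sobolevSpace h (s / γ) :=
    (h.memLp_diffQuot_iff hs u).1 ((memLp_congr_ae hae).2 (Lp.memLp g))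
  exact (LinearPMap.mem_graph_iff _).2
    ⟨⟨u, hmem⟩, rfl, Lp.ext ((coeFn_diffQuotLin h hs ⟨u, hmem⟩).trans hae)⟩

end Sobolev

theorem isComplete_range_subtype_prod {𝕜 E F : Type*} [NontriviallyNormedField 𝕜]
    [NormedAddCommGroup E] [NormedSpace 𝕜 E] [CompleteSpace E]
    [NormedAddCommGroup F] [NormedSpace 𝕜 F] [CompleteSpace F]
    {D K : Submodule 𝕜 E} {T : D →ₗ[𝕜] F} (hT : (LinearPMap.mk D T).IsClosed)
    (hK : IsClosed (K : Set E)) :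
    IsComplete (range ((D ⊓ K).subtype.prod (T ∘ₗ Submodule.inclusion inf_le_left))) := by
  have hgraph : range ((D ⊓ K).subtype.prod (T ∘ₗ Submodule.inclusion inf_le_left)) =
      ((LinearPMap.mk D T).graph : Set (E × F)) ∩ Prod.fst ⁻¹' K := by
    ext ⟨x, y⟩
    constructor
    · rintro ⟨w, hw⟩
      obtain ⟨rfl, rfl⟩ := Prod.ext_iff.1 hw
      exact ⟨(LinearPMap.mem_graph_iff _).2 ⟨⟨w, w.2.1⟩, rfl, rfl⟩, w.2.2⟩
    · rintro ⟨hxy, hx⟩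
      obtain ⟨w, rfl, rfl⟩ := (LinearPMap.mem_graph_iff _).1 hxy
      exact ⟨⟨w, w.2, hx⟩, rfl⟩
  rw [hgraph]
  exact (hT.inter (hK.preimage continuous_fst)).isComplete

section Coercivity

variable {X : Type*} [MetricSpace X] [MeasurableSpace X] {μ : Measure X}

theorem norm_le_sobolevNorm (σ : ℝ) (u : Lp ℝ 2 μ) : ‖u‖ ≤ sobolevNorm μ σ u :=
  le_add_of_nonneg_right (Real.sqrt_nonneg _)

theorem sqrt_energy_le_sobolevNorm (σ : ℝ) (u : Lp ℝ 2 μ) :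
    √(energy μ σ u).toReal ≤ sobolevNorm μ σ u :=
  le_add_of_nonneg_left (norm_nonneg _)

theorem sobolevNorm_nonneg (σ : ℝ) (u : Lp ℝ 2 μ) : 0 ≤ sobolevNorm μ σ u :=
  (norm_nonneg u).trans (norm_le_sobolevNorm σ u)

variable [BorelSpace X] {γ s : ℝ} {h : AhlforsRegular γ μ} {V : Submodule ℝ (Lp ℝ 2 μ)}

theorem isCoercivitySpace_inf (hs : 0 ≤ s) {K : Submodule ℝ (Lp ℝ 2 μ)}
    (hK : IsClosed (K : Set (Lp ℝ 2 μ))) {c : ℝ} (hc : 0 < c)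
    (hcoer : ∀ u ∈ K, ENNReal.ofReal (c * ‖u‖ ^ 2) ≤ energy μ (s / γ) u) :
    IsCoercivitySpace h (s / γ) (sobolevSpace h (s / γ) ⊓ K) where
  le_sobolevSpace := inf_le_left
  coercive := ⟨c, hc, fun u hu => hcoer u hu.2⟩
  complete w hw hcauchy := by
    obtain ⟨A, hA, H⟩ := exists_energy_comparable_norm_diffQuotLin h hs
    set T := diffQuotLin h hs
    have hfst (u : ↥(sobolevSpace h (s / γ) ⊓ K)) : ‖(u : Lp ℝ 2 μ)‖ ≤
        (1 + A) * sobolevNorm μ (s / γ) u :=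
      (norm_le_sobolevNorm (s / γ) (u : Lp ℝ 2 μ)).trans
        (le_mul_of_one_le_left (sobolevNorm_nonneg _ _) (by linarith))
    have hsnd (u : ↥(sobolevSpace h (s / γ) ⊓ K)) : ‖T (Submodule.inclusion inf_le_left u)‖ ≤
        (1 + A) * sobolevNorm μ (s / γ) u :=
      (H (Submodule.inclusion inf_le_left u)).2.trans (mul_le_mul (by linarith)
        (sqrt_energy_le_sobolevNorm _ _) (Real.sqrt_nonneg _) (by linarith))
    have hgraph (u : ↥(sobolevSpace h (s / γ) ⊓ K)) : sobolevNorm μ (s / γ) (u : Lp ℝ 2 μ) ≤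
        (1 + A) * ‖((u : Lp ℝ 2 μ), T (Submodule.inclusion inf_le_left u))‖ := by
      rw [one_add_mul]
      have hTu := norm_snd_le ((u : Lp ℝ 2 μ), T (Submodule.inclusion inf_le_left u))
      exact add_le_add (norm_fst_le ((u : Lp ℝ 2 μ), _))
        ((H (Submodule.inclusion inf_le_left u)).1.trans (mul_le_mul_of_nonneg_left hTu hA.le))
    obtain ⟨u, hu⟩ := (isComplete_range_iff ((sobolevSpace h (s / γ) ⊓ K).subtype.prod
        (T ∘ₗ Submodule.inclusion inf_le_left)).toAddMonoidHom
        (N := fun u => sobolevNorm μ (s / γ) (u : Lp ℝ 2 μ)) (by positivity) (by positivity)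
        (fun u => norm_prod_le_iff.2 ⟨hfst u, hsnd u⟩) hgraph).1
      (isComplete_range_subtype_prod (isClosed_diffQuotLin h hs) hK)
      (fun n => ⟨w n, hw n⟩) hcauchy
    exact ⟨u, u.2, hu⟩

/-- The difference quotient as a linear operator on a space of coercivity. -/
def IsCoercivitySpace.diffQuotLin (hV : IsCoercivitySpace h (s / γ) V) (hs : 0 ≤ s) :
    V →ₗ[ℝ] Lp ℝ 2 (μ.prod μ) :=
  HomType.diffQuotLin h hs ∘ₗ Submodule.inclusion hV.le_sobolevSpace

theorem IsCoercivitySpace.dirichletForm_eq_inner (hV : IsCoercivitySpace h (s / γ) V) (hs : 0 ≤ s)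
    (u v : V) : dirichletForm μ s γ (u : Lp ℝ 2 μ) (v : Lp ℝ 2 μ) =
      inner ℝ (hV.diffQuotLin hs u) (hV.diffQuotLin hs v) :=
  HomType.dirichletForm_eq_inner h hs (Submodule.inclusion hV.le_sobolevSpace u)
    (Submodule.inclusion hV.le_sobolevSpace v)

theorem IsCoercivitySpace.exists_norm_diffQuotLin_le (hV : IsCoercivitySpace h (s / γ) V)
    (hs : 0 ≤ s) : ∃ A : ℝ, 0 < A ∧ ∀ u : V,
      ‖hV.diffQuotLin hs u‖ ≤ A * sobolevNorm μ (s / γ) u := by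
  obtain ⟨A, hA, H⟩ := exists_energy_comparable_norm_diffQuotLin h hs
  exact ⟨A, hA, fun u => (H _).2.trans (by gcongr; exact sqrt_energy_le_sobolevNorm _ _)⟩

theorem IsCoercivitySpace.exists_sobolevNorm_le (hV : IsCoercivitySpace h (s / γ) V)
    (hs : 0 ≤ s) : ∃ B : ℝ, 0 < B ∧ ∀ u : V,
      sobolevNorm μ (s / γ) u ≤ B * ‖hV.diffQuotLin hs u‖ := by
  obtain ⟨A, hA, H⟩ := exists_energy_comparable_norm_diffQuotLin h hs
  obtain ⟨c, hc, hcoer⟩ := hV.coercive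
  refine ⟨((√c)⁻¹ + 1) * A, by positivity, fun u => ?_⟩
  have hu : energy μ (s / γ) (u : Lp ℝ 2 μ) ≠ ∞ := ne_of_lt (hV.le_sobolevSpace u.2)
  have hnorm : √c * ‖(u : Lp ℝ 2 μ)‖ ≤ √(energy μ (s / γ) (u : Lp ℝ 2 μ)).toReal := by
    refine Real.le_sqrt_of_sq_le ?_
    rw [mul_pow, Real.sq_sqrt hc.le]
    exact (ENNReal.ofReal_le_iff_le_toReal hu).1 (hcoer u u.2)
  calc sobolevNorm μ (s / γ) u
      ≤ (√c)⁻¹ * √(energy μ (s / γ) (u : Lp ℝ 2 μ)).toReal +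
          √(energy μ (s / γ) (u : Lp ℝ 2 μ)).toReal :=
        add_le_add_left ((le_inv_mul_iff₀ (by positivity)).2 hnorm) _
    _ = ((√c)⁻¹ + 1) * √(energy μ (s / γ) (u : Lp ℝ 2 μ)).toReal := by ring
    _ ≤ ((√c)⁻¹ + 1) * (A * ‖hV.diffQuotLin hs u‖) := by
        gcongr
        exact (H (Submodule.inclusion hV.le_sobolevSpace u)).1
    _ = ((√c)⁻¹ + 1) * A * ‖hV.diffQuotLin hs u‖ := by ring

theorem IsCoercivitySpace.exists_abs_dirichletForm_le (hV : IsCoercivitySpace h (s / γ) V)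
    (hs : 0 ≤ s) : ∃ C : ℝ, ∀ u ∈ V, ∀ v ∈ V,
      Integrable (dirichletIntegrand s γ u v) (μ.prod μ) ∧
      |dirichletForm μ s γ u v| ≤ C * sobolevNorm μ (s / γ) u * sobolevNorm μ (s / γ) v := by
  obtain ⟨A, hA, H⟩ := hV.exists_norm_diffQuotLin_le hs
  refine ⟨A * A, fun u hu v hv => ⟨integrable_dirichletIntegrand h hs
    ⟨u, hV.le_sobolevSpace hu⟩ ⟨v, hV.le_sobolevSpace hv⟩, ?_⟩⟩
  have := sobolevNorm_nonneg (s / γ) u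
  calc |dirichletForm μ s γ u v|
      = |inner ℝ (hV.diffQuotLin hs ⟨u, hu⟩) (hV.diffQuotLin hs ⟨v, hv⟩)| := by
        rw [← hV.dirichletForm_eq_inner]
    _ ≤ ‖hV.diffQuotLin hs ⟨u, hu⟩‖ * ‖hV.diffQuotLin hs ⟨v, hv⟩‖ := abs_real_inner_le_norm _ _
    _ ≤ (A * sobolevNorm μ (s / γ) u) * (A * sobolevNorm μ (s / γ) v) := by
        gcongr
        exacts [H ⟨u, hu⟩, H ⟨v, hv⟩]
    _ = A * A * sobolevNorm μ (s / γ) u * sobolevNorm μ (s / γ) v := by ring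

theorem IsCoercivitySpace.exists_mul_sq_le_dirichletForm (hV : IsCoercivitySpace h (s / γ) V)
    (hs : 0 ≤ s) : ∃ c : ℝ, 0 < c ∧ ∀ u ∈ V,
      c * sobolevNorm μ (s / γ) u ^ 2 ≤ dirichletForm μ s γ u u := by
  obtain ⟨B, hB, H⟩ := hV.exists_sobolevNorm_le hs
  refine ⟨(B ^ 2)⁻¹, by positivity, fun u hu => ?_⟩
  rw [hV.dirichletForm_eq_inner hs ⟨u, hu⟩ ⟨u, hu⟩, real_inner_self_eq_norm_sq,
    inv_mul_le_iff₀ (by positivity), ← mul_pow]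
  exact pow_le_pow_left₀ (sobolevNorm_nonneg _ _) (H ⟨u, hu⟩) 2

theorem IsCoercivitySpace.existsUnique_dirichletForm_eq (hV : IsCoercivitySpace h (s / γ) V)
    (hs : 0 ≤ s) (f : V →ₗ[ℝ] ℝ) (hf : ∃ K : ℝ, ∀ v : V, |f v| ≤ K * sobolevNorm μ (s / γ) v) :
    ∃! u : V, ∀ v : V, dirichletForm μ s γ (u : Lp ℝ 2 μ) (v : Lp ℝ 2 μ) = f v := by
  obtain ⟨A, hA, hTN⟩ := hV.exists_norm_diffQuotLin_le hs
  obtain ⟨B, hB, hNT⟩ := hV.exists_sobolevNorm_le hs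
  obtain ⟨K, hK⟩ := hf
  have hinj : Function.Injective (hV.diffQuotLin hs) :=
    (injective_iff_map_eq_zero _).2 fun v hv => by
      have hle := (norm_le_sobolevNorm (s / γ) (v : Lp ℝ 2 μ)).trans (hNT v)
      rw [hv, norm_zero, mul_zero] at hle
      exact Subtype.ext (norm_le_zero_iff.1 hle)
  have hcomplete : IsComplete (range (hV.diffQuotLin hs)) := by
    refine (isComplete_range_iff (hV.diffQuotLin hs).toAddMonoidHom hA hB hTN hNT).2
      fun w hw => ?_
    obtain ⟨u, hu, hlim⟩ := hV.complete (fun n => w n) (fun n => (w n).2) hw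
    exact ⟨⟨u, hu⟩, hlim⟩
  simp only [hV.dirichletForm_eq_inner hs]
  refine existsUnique_inner_map_eq _ hinj hcomplete f (K := max K 0 * B) fun v => ?_
  calc |f v| ≤ max K 0 * sobolevNorm μ (s / γ) v :=
        (hK v).trans (mul_le_mul_of_nonneg_right (le_max_left _ _) (sobolevNorm_nonneg _ _))
    _ ≤ max K 0 * (B * ‖hV.diffQuotLin hs v‖) := by
        gcongr
        exact hNT v
    _ = max K 0 * B * ‖hV.diffQuotLin hs v‖ := by ring

end Coercivity

section Poincare

theorem sq_lintegral_le_measure_univ_mul {X : Type*} [MeasurableSpace X] {ν : Measure X}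
    {f : X → ℝ≥0∞} (hf : AEMeasurable f ν) :
    (∫⁻ x, f x ∂ν) ^ 2 ≤ ν univ * ∫⁻ x, f x ^ 2 ∂ν := by
  have h := ENNReal.lintegral_mul_le_Lp_mul_Lq ν Real.HolderConjugate.two_two hf
    (aemeasurable_const (b := 1))
  simp only [Pi.mul_apply, mul_one, ENNReal.rpow_ofNat, one_pow, lintegral_one] at h
  calc (∫⁻ x, f x ∂ν) ^ 2
      ≤ ((∫⁻ x, f x ^ 2 ∂ν) ^ (1 / 2 : ℝ) * ν univ ^ (1 / 2 : ℝ)) ^ 2 := by gcongr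
    _ = ν univ * ∫⁻ x, f x ^ 2 ∂ν := by
        rw [mul_comm, mul_pow, ← ENNReal.rpow_mul_natCast, ← ENNReal.rpow_mul_natCast]
        norm_num

theorem measure_univ_mul_lintegral_enorm_sq_le {X E : Type*} [MeasurableSpace X] {ν : Measure X}
    [IsFiniteMeasure ν] [NormedAddCommGroup E] [NormedSpace ℝ E] [CompleteSpace E] {u : X → E}
    (hu : Integrable u ν) (h0 : ∫ x, u x ∂ν = 0) :
    ν univ * ∫⁻ x, ‖u x‖ₑ ^ 2 ∂ν ≤ ∫⁻ x, ∫⁻ y, ‖u x - u y‖ₑ ^ 2 ∂ν ∂ν := by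
  rcases eq_or_ne (ν univ) 0 with hν | hν
  · simp only [hν, zero_mul, zero_le]
  have hν' := measure_ne_top ν univ
  rw [← lintegral_const_mul' _ _ hν']
  refine lintegral_mono fun x => ?_
  refine (ENNReal.mul_le_mul_iff_right hν hν').1 ?_
  have hmean : ν univ * ‖u x‖ₑ ≤ ∫⁻ y, ‖u x - u y‖ₑ ∂ν :=
    calc ν univ * ‖u x‖ₑ = ‖∫ y, (u x - u y) ∂ν‖ₑ := by
          rw [integral_sub (integrable_const _) hu, h0, sub_zero, integral_const, enorm_smul,
            Real.enorm_of_nonneg measureReal_nonneg, ofReal_measureReal]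
      _ ≤ ∫⁻ y, ‖u x - u y‖ₑ ∂ν := enorm_integral_le_lintegral_enorm _
  calc ν univ * (ν univ * ‖u x‖ₑ ^ 2) = (ν univ * ‖u x‖ₑ) ^ 2 := by ring
    _ ≤ (∫⁻ y, ‖u x - u y‖ₑ ∂ν) ^ 2 := by gcongr
    _ ≤ ν univ * ∫⁻ y, ‖u x - u y‖ₑ ^ 2 ∂ν := sq_lintegral_le_measure_univ_mul
        (aestronglyMeasurable_const.sub hu.aestronglyMeasurable).enorm

variable {X : Type*} [MetricSpace X] [MeasurableSpace X] {μ : Measure X} {s γ d : ℝ}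

theorem setLIntegral_enorm_sub_sq_le (hsγ : 0 ≤ γ + 2 * s) (u : X → ℝ) {Q : Set X}
    (hQm : MeasurableSet Q) (hQ : ∀ x ∈ Q, ∀ y ∈ Q, dist x y ≤ d) :
    ∫⁻ p in Q ×ˢ Q, ‖u p.1 - u p.2‖ₑ ^ 2 ∂(μ.prod μ) ≤ ENNReal.ofReal (d ^ (γ + 2 * s)) *
      ∫⁻ p in Q ×ˢ Q, ‖diffQuot s γ u p‖ₑ ^ 2 ∂(μ.prod μ) := by
  rw [← lintegral_const_mul' _ _ ENNReal.ofReal_ne_top]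
  refine setLIntegral_mono' (hQm.prod hQm) fun p hp => ?_
  rcases eq_or_ne p.1 p.2 with hxy | hxy
  · simp [hxy]
  have hdist : 0 < dist p.1 p.2 ^ (γ + 2 * s) := Real.rpow_pos_of_pos (dist_pos.2 hxy) _
  rw [enorm_diffQuot_sq, ← mul_div_assoc, ENNReal.le_div_iff_mul_le
    (Or.inl (ENNReal.ofReal_pos.2 hdist).ne') (Or.inl ENNReal.ofReal_ne_top), mul_comm]
  gcongr
  exact hQ _ hp.1 _ hp.2

theorem measure_mul_setLIntegral_enorm_sq_le [SFinite μ] (hsγ : 0 ≤ γ + 2 * s) {u : X → ℝ}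
    {Q : Set X} (hQm : MeasurableSet Q) (hμQ : μ Q ≠ ∞) (hQ : ∀ x ∈ Q, ∀ y ∈ Q, dist x y ≤ d)
    (hu : IntegrableOn u Q μ) (h0 : ∫ x in Q, u x ∂μ = 0) :
    μ Q * ∫⁻ x in Q, ‖u x‖ₑ ^ 2 ∂μ ≤ ENNReal.ofReal (d ^ (γ + 2 * s)) *
      ∫⁻ p in Q ×ˢ Q, ‖diffQuot s γ u p‖ₑ ^ 2 ∂(μ.prod μ) := by
  have := isFiniteMeasure_restrict.2 hμQ
  have hsm := hu.aestronglyMeasurable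
  calc μ Q * ∫⁻ x in Q, ‖u x‖ₑ ^ 2 ∂μ
      ≤ ∫⁻ x in Q, ∫⁻ y in Q, ‖u x - u y‖ₑ ^ 2 ∂μ ∂μ := by
        rw [← Measure.restrict_apply_univ Q]
        exact measure_univ_mul_lintegral_enorm_sq_le hu h0
    _ = ∫⁻ p in Q ×ˢ Q, ‖u p.1 - u p.2‖ₑ ^ 2 ∂(μ.prod μ) := by
        rw [← Measure.prod_restrict]
        exact (lintegral_prod _ ((hsm.comp_fst.sub hsm.comp_snd).enorm.pow_const 2)).symm
    _ ≤ _ := setLIntegral_enorm_sub_sq_le hsγ u hQm hQ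

theorem mul_lintegral_enorm_sq_le_distEnergy [SFinite μ] (hsγ : 0 ≤ γ + 2 * s) {u : X → ℝ}
    {𝒬 : Set (Set X)} (h𝒬 : 𝒬.Countable) (hdisj : 𝒬.PairwiseDisjoint id) (hcover : ⋃₀ 𝒬 = univ)
    (hm : ∀ Q ∈ 𝒬, MeasurableSet Q) {m : ℝ≥0∞} (hmμ : ∀ Q ∈ 𝒬, m ≤ μ Q)
    (hμ : ∀ Q ∈ 𝒬, μ Q ≠ ∞) (hd : ∀ Q ∈ 𝒬, ∀ x ∈ Q, ∀ y ∈ Q, dist x y ≤ d)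
    (hu : ∀ Q ∈ 𝒬, IntegrableOn u Q μ) (h0 : ∀ Q ∈ 𝒬, ∫ x in Q, u x ∂μ = 0) :
    m * ∫⁻ x, ‖u x‖ₑ ^ 2 ∂μ ≤ ENNReal.ofReal (d ^ (γ + 2 * s)) * distEnergy μ s γ u := by
  have hdisj' : 𝒬.PairwiseDisjoint fun Q => Q ×ˢ Q := fun Q hQ R hR hQR =>
    disjoint_prod.2 (Or.inl (hdisj hQ hR hQR))
  calc m * ∫⁻ x, ‖u x‖ₑ ^ 2 ∂μ
      = ∑' Q : 𝒬, m * ∫⁻ x in Q, ‖u x‖ₑ ^ 2 ∂μ := by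
        rw [ENNReal.tsum_mul_left, ← lintegral_biUnion h𝒬 hm hdisj, ← sUnion_eq_biUnion, hcover,
          setLIntegral_univ]
    _ ≤ ∑' Q : 𝒬, ENNReal.ofReal (d ^ (γ + 2 * s)) *
          ∫⁻ p in (Q : Set X) ×ˢ (Q : Set X), ‖diffQuot s γ u p‖ₑ ^ 2 ∂(μ.prod μ) := by
        refine ENNReal.tsum_le_tsum fun ⟨Q, hQ⟩ => ?_
        refine le_trans ?_ (measure_mul_setLIntegral_enorm_sq_le hsγ (hm Q hQ) (hμ Q hQ)
          (hd Q hQ) (hu Q hQ) (h0 Q hQ))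
        gcongr
        exact hmμ Q hQ
    _ ≤ ENNReal.ofReal (d ^ (γ + 2 * s)) * distEnergy μ s γ u := by
        rw [ENNReal.tsum_mul_left,
          ← lintegral_biUnion h𝒬 (fun Q hQ => (hm Q hQ).prod (hm Q hQ)) hdisj']
        gcongr
        exact setLIntegral_le_lintegral _ _

end Poincare

section Cubes

variable {X : Type*} [MetricSpace X]

theorem exists_ball_subset_of_lt_eccentricity {Q : Set X} {c r : ℝ} (hc : 0 ≤ c)
    (hcQ : ENNReal.ofReal c < eccentricity Q) (hrQ : ENNReal.ofReal r ≤ Metric.ediam Q) :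
    ∃ x, Metric.ball x (c * r / 2) ⊆ Q := by
  simp only [eccentricity, lt_iSup_iff] at hcQ
  obtain ⟨x₁, r₁, x₂, r₂, hr₁, hr₂, hsub₁, hsub₂, hlt⟩ := hcQ
  rw [ENNReal.ofReal_lt_ofReal_iff (by positivity), lt_div_iff₀ hr₂] at hlt
  have hdiam : Metric.ediam Q ≤ ENNReal.ofReal (2 * r₂) := by
    refine Metric.ediam_le fun x hx y hy => ?_
    rw [edist_dist]
    refine ENNReal.ofReal_le_ofReal ((dist_triangle_right x y x₂).trans ?_)
    rw [two_mul]
    exact add_le_add (Metric.mem_ball.1 (hsub₂ hx)).le (Metric.mem_ball.1 (hsub₂ hy)).le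
  have hr : r ≤ 2 * r₂ := (ENNReal.ofReal_le_ofReal_iff (by positivity)).1 (hrQ.trans hdiam)
  exact ⟨x₁, (Metric.ball_subset_ball (by nlinarith)).trans hsub₁⟩

variable [MeasurableSpace X] {γ : ℝ} {μ : Measure X} {D : ℤ → Set (Set X)} {j : ℤ} {Q R : Set X}

theorem IsDyadicFamily.exists_le_measure_and_dist_le (hD : IsDyadicFamily D)
    (h : AhlforsRegular γ μ) :
    ∃ ν b C : ℝ, 0 < ν ∧ ν < 1 ∧ 0 < b ∧ 0 < C ∧ ∀ j : ℤ, ∀ Q ∈ D j,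
      ENNReal.ofReal (b * (ν ^ j) ^ γ) ≤ μ Q ∧ ∀ x ∈ Q, ∀ y ∈ Q, dist x y ≤ C * ν ^ j := by
  obtain ⟨ν, hν0, hν1, c, C, hc, hC, H⟩ := hD.size
  obtain ⟨c₁, c₂, h₁, -, Hμ⟩ := h.regular
  refine ⟨ν, c₁ * (c ^ 2 / 4) ^ γ, C, hν0, hν1, by positivity, hC, fun j Q hQ => ⟨?_, ?_⟩⟩
  · obtain ⟨⟨hdiam, -⟩, hecc, -⟩ := H j Q hQ
    have hecc' : ENNReal.ofReal (c / 2) < eccentricity Q :=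
      ((ENNReal.ofReal_lt_ofReal_iff hc).2 (half_lt_self hc)).trans_le hecc
    obtain ⟨x, hx⟩ := exists_ball_subset_of_lt_eccentricity (by positivity) hecc' hdiam
    calc ENNReal.ofReal (c₁ * (c ^ 2 / 4) ^ γ * (ν ^ j) ^ γ)
        = ENNReal.ofReal (c₁ * (c / 2 * (c * ν ^ j) / 2) ^ γ) := by
          rw [mul_assoc, ← Real.mul_rpow (by positivity) (by positivity)]
          ring_nf
      _ ≤ μ (Metric.ball x (c / 2 * (c * ν ^ j) / 2)) := (Hμ x _ (by positivity)).1
      _ ≤ μ Q := measure_mono hx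
  · intro x hx y hy
    have hxy := (Metric.edist_le_ediam_of_mem hx hy).trans (H j Q hQ).1.2
    rwa [edist_dist, ENNReal.ofReal_le_ofReal_iff (by positivity)] at hxy

theorem IsDyadicFamily.measure_lt_top (hD : IsDyadicFamily D) (h : AhlforsRegular γ μ)
    (hQ : Q ∈ D j) : μ Q < ∞ := by
  obtain ⟨ν, b, C, -, -, -, -, H⟩ := hD.exists_le_measure_and_dist_le h
  exact h.measure_lt_top (Metric.isBounded_iff.2 ⟨_, fun x hx y hy => (H j Q hQ).2 x hx y hy⟩)

theorem IsDyadicFamily.measure_pos (hD : IsDyadicFamily D) (h : AhlforsRegular γ μ)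
    (hQ : Q ∈ D j) : 0 < μ Q := by
  obtain ⟨ν, b, C, hν, -, hb, -, H⟩ := hD.exists_le_measure_and_dist_le h
  exact (ENNReal.ofReal_pos.2 (by positivity)).trans_le (H j Q hQ).1

theorem IsDyadicFamily.exists_forall_lt_measure (hD : IsDyadicFamily D) (h : AhlforsRegular γ μ)
    (i : ℤ) {M : ℝ≥0∞} (hM : M ≠ ∞) : ∃ n : ℕ, ∀ Q ∈ D (i - n), M < μ Q := by
  obtain ⟨ν, b, C, hν, hν1, hb, -, H⟩ := hD.exists_le_measure_and_dist_le h
  have hpow : Tendsto (fun n : ℕ => ν ^ i * ν⁻¹ ^ n) atTop atTop :=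
    (tendsto_pow_atTop_atTop_of_one_lt ((one_lt_inv₀ hν).2 hν1)).const_mul_atTop (zpow_pos hν i)
  obtain ⟨n, hn⟩ := ((((tendsto_rpow_atTop h.pos).comp hpow).const_mul_atTop
    hb).eventually_gt_atTop M.toReal).exists
  refine ⟨n, fun Q hQ => lt_of_lt_of_le ?_ (H _ Q hQ).1⟩
  rwa [ENNReal.lt_ofReal_iff_toReal_lt hM, zpow_sub₀ hν.ne', zpow_natCast, div_eq_mul_inv,
    ← inv_pow]

theorem IsDyadicFamily.subset_or_disjoint (hD : IsDyadicFamily D) (hQ : Q ∈ D j) (hR : R ∈ D j) :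
    Q ⊆ R ∨ Disjoint Q R := by
  rcases eq_or_ne Q R with rfl | hne
  · exact Or.inl subset_rfl
  · exact Or.inr ((hD.partition j).pairwiseDisjoint hQ hR hne)

variable [BorelSpace X] {s : ℝ}

theorem IsDyadicFamily.exists_coercive (hD : IsDyadicFamily D) (h : AhlforsRegular γ μ)
    (hs : 0 ≤ s) (j : ℤ) : ∃ c : ℝ, 0 < c ∧ ∀ u : Lp ℝ 2 μ, (∀ Q ∈ D j, ∫ x in Q, u x ∂μ = 0) →
      ENNReal.ofReal (c * ‖u‖ ^ 2) ≤ energy μ (s / γ) u := by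
  have := h.sigmaFinite
  have hγ := h.pos
  obtain ⟨ν, b, C, hν, -, hb, hC, H⟩ := hD.exists_le_measure_and_dist_le h
  obtain ⟨A, hA, HA⟩ := h.energy_comparable hs
  set m : ℝ := b * (ν ^ j) ^ γ
  set d : ℝ := (C * ν ^ j) ^ (γ + 2 * s)
  have hcount : (D j).Countable := countable_of_pairwiseDisjoint_of_measure_pos
    (hD.measurableSet j) (hD.partition j).pairwiseDisjoint fun Q hQ => hD.measure_pos h hQ
  have hd : 0 < d := by positivity
  refine ⟨m / (d * A), by positivity, fun u hu => ?_⟩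
  have hmain : ENNReal.ofReal m * ‖u‖ₑ ^ 2 ≤
      ENNReal.ofReal d * (A * energy μ (s / γ) u) := by
    rw [enorm_sq_eq_lintegral]
    refine (mul_lintegral_enorm_sq_le_distEnergy (by positivity) hcount
      (hD.partition j).pairwiseDisjoint (hD.partition j).sUnion_eq_univ (hD.measurableSet j)
      (fun Q hQ => (H j Q hQ).1) (fun Q hQ => (hD.measure_lt_top h hQ).ne)
      (fun Q hQ => (H j Q hQ).2) (fun Q hQ => integrableOn_Lp_of_measure_ne_top u (by norm_num)
        (hD.measure_lt_top h hQ).ne) hu).trans (mul_le_mul_right (HA u).2 _)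
  rw [div_mul_eq_mul_div, ENNReal.ofReal_div_of_pos (by positivity)]
  refine ENNReal.div_le_of_le_mul' ?_
  rwa [ENNReal.ofReal_mul (by positivity), ENNReal.ofReal_mul hd.le, ENNReal.ofReal_coe_nnreal,
    ENNReal.ofReal_pow (norm_nonneg u), ofReal_norm, mul_assoc]

theorem IsDyadicFamily.isCoercivitySpace_inf (hD : IsDyadicFamily D) (h : AhlforsRegular γ μ)
    (hs : 0 ≤ s) {K : Submodule ℝ (Lp ℝ 2 μ)} (hK : IsClosed (K : Set (Lp ℝ 2 μ)))
    (hmean : ∀ u ∈ K, ∀ Q ∈ D j, ∫ x in Q, u x ∂μ = 0) :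
    IsCoercivitySpace h (s / γ) (sobolevSpace h (s / γ) ⊓ K) := by
  obtain ⟨c, hc, H⟩ := hD.exists_coercive h hs j
  exact HomType.isCoercivitySpace_inf hs hK hc fun u hu => H u (hmean u hu)

end Cubes

section Averages

variable {X : Type*} [MeasurableSpace X] {μ : Measure X}

theorem measure_mul_enorm_setAverage_sq_le {E : Type*} [NormedAddCommGroup E] [NormedSpace ℝ E]
    (u : Lp E 2 μ) {Q : Set X} (hQ : μ Q ≠ ∞) :
    μ Q * ‖⨍ x in Q, u x ∂μ‖ₑ ^ 2 ≤ ‖u‖ₑ ^ 2 := by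
  rcases eq_or_ne (μ Q) 0 with hQ0 | hQ0
  · simp only [hQ0, zero_mul, zero_le]
  refine (ENNReal.mul_le_mul_iff_right hQ0 hQ).1 ?_
  calc μ Q * (μ Q * ‖⨍ x in Q, u x ∂μ‖ₑ ^ 2) = (μ Q * ‖⨍ x in Q, u x ∂μ‖ₑ) ^ 2 := by ring
    _ = ‖∫ x in Q, u x ∂μ‖ₑ ^ 2 := by
        rw [← measure_smul_setAverage _ hQ, enorm_smul, Real.enorm_of_nonneg measureReal_nonneg,
          ofReal_measureReal]
    _ ≤ (∫⁻ x in Q, ‖u x‖ₑ ∂μ) ^ 2 := by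
        gcongr
        exact enorm_integral_le_lintegral_enorm _
    _ ≤ μ Q * ∫⁻ x in Q, ‖u x‖ₑ ^ 2 ∂μ := by
        rw [← Measure.restrict_apply_univ Q]
        exact sq_lintegral_le_measure_univ_mul (Lp.aestronglyMeasurable u).restrict.enorm
    _ ≤ μ Q * ‖u‖ₑ ^ 2 := by
        rw [enorm_sq_eq_lintegral]
        gcongr
        exact Measure.restrict_le_self

theorem indicatorConstLp_mem_stepSpace {𝒬 : Set (Set X)} {Q S : Set X} (hQ : MeasurableSet Q)
    (hμQ : μ Q ≠ ∞) (hQS : Q ⊆ S) (h𝒬 : ∀ R ∈ 𝒬, R ⊆ Q ∨ Disjoint R Q) :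
    indicatorConstLp 2 hQ hμQ (1 : ℝ) ∈ stepSpace μ 𝒬 S := by
  have hae := indicatorConstLp_coeFn (p := 2) (hs := hQ) (hμs := hμQ) (c := (1 : ℝ))
  refine ⟨fun R hR => ?_, ?_⟩
  · rcases h𝒬 R hR with hRQ | hRQ
    · refine ⟨1, ?_⟩
      filter_upwards [hae] with x hx hxR
      rw [hx, indicator_of_mem (hRQ hxR)]
    · refine ⟨0, ?_⟩
      filter_upwards [hae] with x hx hxR
      rw [hx, indicator_of_notMem (hRQ.notMem_of_mem_left hxR)]
  · filter_upwards [hae] with x hx hxS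
    rw [hx, indicator_of_notMem fun hxQ => hxS (hQS hxQ)]

theorem normIndicator_eq_smul {Q : Set X} (hQ : MeasurableSet Q) (hμQ : μ Q ≠ ∞) :
    normIndicator μ Q = (1 / √(μ.real Q)) • indicatorConstLp 2 hQ hμQ (1 : ℝ) := by
  have hmem : MemLp (Q.indicator fun _ => (1 / √(μ.real Q) : ℝ)) 2 μ :=
    memLp_indicator_const 2 hQ _ (Or.inr hμQ)
  rw [normIndicator, dif_pos hmem]
  refine Lp.ext (hmem.coeFn_toLp.trans ?_)
  filter_upwards [indicatorConstLp_coeFn (p := 2) (hs := hQ) (hμs := hμQ) (c := (1 : ℝ)),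
    Lp.coeFn_smul (1 / √(μ.real Q)) (indicatorConstLp 2 hQ hμQ (1 : ℝ))] with x hind hsmul
  rw [hsmul, Pi.smul_apply, hind]
  by_cases hx : x ∈ Q <;> simp [hx]

theorem inner_eq_zero_of_haarProj_eq_zero {D : ℤ → Set (Set X)}
    {𝓗 : ℤ → Set X → Set (Lp ℝ 2 μ)} {t : ℝ} {u : Lp ℝ 2 μ} (hu : haarProj μ D 𝓗 t u = 0)
    {j : ℤ} {Q : Set X} (hQ : Q ∈ D j) (ht : ENNReal.ofReal t < μ Q) {g : Lp ℝ 2 μ}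
    (hg : g ∈ 𝓗 j Q) : inner ℝ g u = 0 := by
  rw [haarProj, Submodule.starProjection_apply_eq_zero_iff] at hu
  exact hu _ (Submodule.le_topologicalClosure _ (Submodule.subset_span ⟨j, Q, hQ, ht, hg⟩))

end Averages

section Projections

variable {X : Type*} [MetricSpace X] [MeasurableSpace X] {μ : Measure X} {γ s t : ℝ}
  {D : ℤ → Set (Set X)} {𝓗 : ℤ → Set X → Set (Lp ℝ 2 μ)} {j : ℤ} {Q Q' : Set X} {u : Lp ℝ 2 μ}

theorem IsDyadicFamily.setIntegral_eq_zero_of_levelProj_eq_zero (hD : IsDyadicFamily D)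
    (h : AhlforsRegular γ μ) (hu : levelProj μ D j u = 0) (hQ : Q ∈ D j) :
    ∫ x in Q, u x ∂μ = 0 := by
  rw [levelProj, Submodule.starProjection_apply_eq_zero_iff] at hu
  rw [← L2.inner_indicatorConstLp_one (𝕜 := ℝ) (hD.measurableSet j Q hQ)
    (hD.measure_lt_top h hQ).ne]
  exact hu _ (Submodule.le_topologicalClosure _ (indicatorConstLp_mem_stepSpace _ _
    (subset_univ _) fun R hR => hD.subset_or_disjoint hR hQ))

theorem IsHaarSystem.setAverage_offspring_eq (h𝓗 : IsHaarSystem μ D 𝓗) (hD : IsDyadicFamily D)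
    (h : AhlforsRegular γ μ) (hQ : Q ∈ D j) (hQ' : Q' ∈ offspring D j Q)
    (hu : ∀ g ∈ 𝓗 j Q, inner ℝ g u = 0) : ⨍ x in Q', u x ∂μ = ⨍ x in Q, u x ∂μ := by
  have hm := hD.measurableSet j Q hQ
  have hm' := hD.measurableSet _ Q' hQ'.1
  have hμ := (hD.measure_lt_top h hQ).ne
  have hμ' := (hD.measure_lt_top h hQ'.1).ne
  have hpos : μ.real Q ≠ 0 := (ENNReal.toReal_pos (hD.measure_pos h hQ).ne' hμ).ne'
  have hpos' : μ.real Q' ≠ 0 := (ENNReal.toReal_pos (hD.measure_pos h hQ'.1).ne' hμ').ne'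
  set g : Lp ℝ 2 μ := (μ.real Q')⁻¹ • indicatorConstLp 2 hm' hμ' (1 : ℝ) -
    (μ.real Q)⁻¹ • indicatorConstLp 2 hm hμ (1 : ℝ) with hg
  have hinner (v : Lp ℝ 2 μ) : inner ℝ g v = ⨍ x in Q', v x ∂μ - ⨍ x in Q, v x ∂μ := by
    rw [hg, inner_sub_left, real_inner_smul_left, real_inner_smul_left,
      L2.inner_indicatorConstLp_one, L2.inner_indicatorConstLp_one, setAverage_eq, setAverage_eq,
      smul_eq_mul, smul_eq_mul]
  have hstep : g ∈ stepSpace μ (offspring D j Q) Q := by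
    refine Submodule.sub_mem _ (Submodule.smul_mem _ _ ?_) (Submodule.smul_mem _ _ ?_)
    · exact indicatorConstLp_mem_stepSpace _ _ hQ'.2 fun R hR => hD.subset_or_disjoint hR.1 hQ'.1
    · exact indicatorConstLp_mem_stepSpace _ _ subset_rfl fun R hR => Or.inl hR.2
  have horth : inner ℝ (normIndicator μ Q) g = 0 := by
    rw [normIndicator_eq_smul hm hμ, real_inner_smul_left, hg, inner_sub_right, inner_smul_right,
      inner_smul_right, L2.inner_indicatorConstLp_indicatorConstLp,
      L2.inner_indicatorConstLp_indicatorConstLp, inter_self, inter_eq_right.2 hQ'.2]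
    simp [hpos, hpos']
  have hspan : g ∈ Submodule.span ℝ (𝓗 j Q) := by
    refine mem_span_of_mem_span_insert_of_inner_eq_zero (fun y hy => ?_)
      (h𝓗.span_eq j Q hQ ▸ hstep) horth
    refine (h𝓗.orthonormal j Q hQ).2 (i := ⟨_, mem_insert _ _⟩)
      (j := ⟨y, mem_insert_of_mem _ hy⟩) fun heq => h𝓗.notMem j Q hQ ?_
    rwa [Subtype.mk.inj heq]
  have hgu : inner ℝ g u = 0 := Submodule.mem_orthogonal_singleton_iff_inner_left.1
    (Submodule.span_le.2 (fun y hy => Submodule.mem_orthogonal_singleton_iff_inner_left.2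
      (hu y hy)) hspan)
  exact sub_eq_zero.1 ((hinner u).symm.trans hgu)

theorem IsHaarSystem.exists_ancestor_setAverage_eq (h𝓗 : IsHaarSystem μ D 𝓗)
    (hD : IsDyadicFamily D) (h : AhlforsRegular γ μ) (hu : haarProj μ D 𝓗 t u = 0)
    (hQ : Q ∈ D j) (ht : ENNReal.ofReal t < μ Q) (n : ℕ) :
    ∃ R ∈ D (j - n), Q ⊆ R ∧ ⨍ x in Q, u x ∂μ = ⨍ x in R, u x ∂μ := by
  induction n with
  | zero => exact ⟨Q, by simpa using hQ, subset_rfl, rfl⟩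
  | succ n ih =>
    obtain ⟨R, hR, hQR, heq⟩ := ih
    have hR' : R ∈ D (j - (n + 1 : ℕ) + 1) := by
      convert hR using 2
      push_cast
      ring
    obtain ⟨S, ⟨hS, hRS⟩, -⟩ := hD.parent _ R hR'
    have htS := ht.trans_le (measure_mono (hQR.trans hRS))
    exact ⟨S, hS, hQR.trans hRS, heq.trans (h𝓗.setAverage_offspring_eq hD h hS ⟨hR', hRS⟩
      fun g hg => inner_eq_zero_of_haarProj_eq_zero hu hS htS hg)⟩

theorem IsHaarSystem.setIntegral_eq_zero_of_haarProj_eq_zero (h𝓗 : IsHaarSystem μ D 𝓗)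
    (hD : IsDyadicFamily D) (h : AhlforsRegular γ μ) (hu : haarProj μ D 𝓗 t u = 0)
    (hQ : Q ∈ D j) (ht : ENNReal.ofReal t < μ Q) : ∫ x in Q, u x ∂μ = 0 := by
  suffices ⨍ x in Q, u x ∂μ = 0 by
    rw [← measure_smul_setAverage _ (hD.measure_lt_top h hQ).ne, this, smul_zero]
  by_contra hne
  have hne' : ‖⨍ x in Q, u x ∂μ‖ₑ ^ 2 ≠ 0 := pow_ne_zero 2 (enorm_ne_zero.2 hne)
  obtain ⟨n, hn⟩ := hD.exists_forall_lt_measure h j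
    (ENNReal.div_ne_top (by finiteness : ‖u‖ₑ ^ 2 ≠ ∞) hne')
  obtain ⟨R, hR, -, heq⟩ := h𝓗.exists_ancestor_setAverage_eq hD h hu hQ ht n
  have hlt : ‖u‖ₑ ^ 2 < μ R * ‖⨍ x in Q, u x ∂μ‖ₑ ^ 2 :=
    (ENNReal.div_lt_iff (Or.inl hne') (Or.inl (by finiteness))).1 (hn R hR)
  rw [heq] at hlt
  exact hlt.not_ge (measure_mul_enorm_setAverage_sq_le u (hD.measure_lt_top h hR).ne)

variable [BorelSpace X]

theorem IsDyadicFamily.isCoercivitySpace_inf_ker_levelProj (hD : IsDyadicFamily D)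
    (h : AhlforsRegular γ μ) (hs : 0 ≤ s) (j : ℤ) :
    IsCoercivitySpace h (s / γ) (sobolevSpace h (s / γ) ⊓ (levelProj μ D j).ker) :=
  hD.isCoercivitySpace_inf h hs (levelProj μ D j).isClosed_ker fun _ hu _ hQ =>
    hD.setIntegral_eq_zero_of_levelProj_eq_zero h hu hQ

theorem IsHaarSystem.isCoercivitySpace_inf_ker_haarProj (h𝓗 : IsHaarSystem μ D 𝓗)
    (hD : IsDyadicFamily D) (h : AhlforsRegular γ μ) (hs : 0 ≤ s) (t : ℝ) :
    IsCoercivitySpace h (s / γ) (sobolevSpace h (s / γ) ⊓ (haarProj μ D 𝓗 t).ker) := by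
  obtain ⟨n, hn⟩ := hD.exists_forall_lt_measure h 0 (ENNReal.ofReal_ne_top (r := t))
  exact hD.isCoercivitySpace_inf h hs (haarProj μ D 𝓗 t).isClosed_ker fun _ hu _ hQ =>
    h𝓗.setIntegral_eq_zero_of_haarProj_eq_zero hD h hu hQ (hn _ hQ)

end Projections

end HomType

end

theorem theorem5p1 {X : Type*} [MetricSpace X] [MeasurableSpace X] [BorelSpace X]
    (μ : Measure X) (γ s : ℝ) (hs : 0 < s) (hμ : HomType.AhlforsRegular γ μ) :
    (∀ D : ℤ → Set (Set X), HomType.IsDyadicFamily D →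
      (∀ 𝓗 : ℤ → Set X → Set (Lp ℝ 2 μ), HomType.IsHaarSystem μ D 𝓗 → ∀ t : ℝ, 0 < t →
        HomType.IsCoercivitySpace hμ (s / γ)
          (HomType.sobolevSpace hμ (s / γ) ⊓ (HomType.haarProj μ D 𝓗 t).ker)) ∧
      (∀ j : ℤ, HomType.IsCoercivitySpace hμ (s / γ)
          (HomType.sobolevSpace hμ (s / γ) ⊓ (HomType.levelProj μ D j).ker))) ∧
    ∀ V : Submodule ℝ (Lp ℝ 2 μ), HomType.IsCoercivitySpace hμ (s / γ) V →
      (∃ C : ℝ, ∀ u ∈ V, ∀ v ∈ V,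
        Integrable (HomType.dirichletIntegrand s γ u v) (μ.prod μ) ∧
        |HomType.dirichletForm μ s γ u v| ≤
          C * HomType.sobolevNorm μ (s / γ) u * HomType.sobolevNorm μ (s / γ) v) ∧
      (∃ c : ℝ, 0 < c ∧ ∀ u ∈ V,
        c * HomType.sobolevNorm μ (s / γ) u ^ 2 ≤ HomType.dirichletForm μ s γ u u) ∧
      ∀ f : V →ₗ[ℝ] ℝ,
        (∃ K : ℝ, ∀ v : V, |f v| ≤ K * HomType.sobolevNorm μ (s / γ) v) →
        ∃! u : V, ∀ v : V,
          HomType.dirichletForm μ s γ (u : Lp ℝ 2 μ) (v : Lp ℝ 2 μ) = f v := by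
  refine ⟨fun D hD => ⟨fun 𝓗 h𝓗 t _ => ?_, fun j => ?_⟩, fun V hV => ⟨?_, ?_, fun f hf => ?_⟩⟩
  · exact h𝓗.isCoercivitySpace_inf_ker_haarProj hD hμ hs.le t
  · exact hD.isCoercivitySpace_inf_ker_levelProj hμ hs.le j
  · exact hV.exists_abs_dirichletForm_le hs.le
  · exact hV.exists_mul_sq_le_dirichletForm hs.le
  · exact hV.existsUnique_dirichletForm_eq hs.le f hf
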